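/- Let $p$ be an odd prime and let $A$ be a commutative $\mathbb{Z}_{(p)}$-algebra which is $p$-torsion-free (that is, $pa=0$ implies $a=0$ for $a\in A$). Let $W_n(A)$ denote the ring of $p$-typical Witt vectors of length $n$, and let $W_\cdot\Omega^\bullet_A$ denote the absolute $p$-typical de Rham–Witt complex over $A$ of Hesselholt and Madsen, i.e. the initial object in the category of Witt complexes over $A$. (A Witt complex is a system of graded-commutative differential graded rings $E_n^\bullet$, $n\ge 1$, with restriction maps $R:E_{n+1}^\bullet\to E_n^\bullet$ of differential graded rings, ring homomorphisms $\lambda:W_n(A)\to E_n^0$, homomorphisms of graded rings $F:E_{n+1}^\bullet\to E_n^\bullet$ and additive maps $V:E_n^\bullet\to E_{n+1}^\bullet$ of degree zero, such that $\lambda$ commutes with $R,F,V$, $R$ commutes with $F$ and $V$, $V(F(x)y)=xV(y)$, $FdV=d$, $FV=p$, and $Fd\lambda([a])=\lambda([a]^{p-1})\,d\lambda([a])$ for all $a\in A$, where $[a]$ is the Teichmüller representative.) Write $\Omega^1_A=\Omega^1_{A/\mathbb{Z}}$ for the absolute Kähler differentials, and regard $A=W_1(A)$ and $\Omega^1_A$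 as mapping to level one of the de Rham–Witt complex by the canonical maps $a\mapsto\lambda(a)$ and $a\,db\mapsto\lambda(a)\,d\lambda(b)$. Assume that for every integer $n\ge 1$ the sequence \[ 0\to A\xrightarrow{(-d,\;p^n)}\Omega^1_A\oplus A\xrightarrow{V^n\oplus dV^n}W_{n+1}\Omega^1_A\xrightarrow{R}W_n\Omega^1_A\to 0 \] is exact, where the middle map is $(\alpha,a)\mapsto V^n(\alpha)+dV^n(a)$. Then for all integers $m,n\ge 1$ the map \[ V^m: W_n\Omega^1_A\to W_{n+m}\Omega^1_A \] is injective. -/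

import Mathlib

universe u v w

noncomputable section

/-- The ring `ℤ_(p)`, the localization of `ℤ` at the prime ideal `(p)`. -/
abbrev ZLocalized (p : ℕ) [Fact p.Prime] : Type :=
  Localization.AtPrime (Ideal.span {(p : ℤ)})

/-- A `p`-typical Witt complex over a ring `A` (for `p` odd and `A` a `ℤ_(p)`-algebra), in the sense
of Hesselholt and Madsen, written out degree by degree.  `X n i` is the piece of level `n` and
degree `i`; `W_n(A)` is `TruncatedWittVector p n A`.  Level `0` is the zero object, because
`W_0(A)` is the zero ring.

Each level is a graded-commutative differential graded ring: the product
`X n i × X n j → X n (i + j)` is written `mul h` with `h : i + j = k`, so that no casts between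
the types `X n (i + j)` are needed. -/
structure WittComplex (p : ℕ) [Fact p.Prime] (A : Type u) [CommRing A] where
  /-- the group of level `n` and degree `i` -/
  X : ℕ → ℕ → Type v
  [addCommGroup : ∀ n i, AddCommGroup (X n i)]
  /-- the unit -/
  one : ∀ n, X n 0
  /-- the graded product -/
  mul : ∀ {n i j k : ℕ}, i + j = k → X n i → X n j → X n k
  /-- the differential -/
  d : ∀ {n i : ℕ}, X n i →+ X n (i + 1)
  /-- the structure map from the Witt vectors to the degree zero part -/
  lam : ∀ {n : ℕ}, TruncatedWittVector p n A →+ X n 0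
  /-- restriction -/
  R : ∀ {n i : ℕ}, X (n + 1) i →+ X n i
  /-- Frobenius -/
  F : ∀ {n i : ℕ}, X (n + 1) i →+ X n i
  /-- Verschiebung -/
  V : ∀ {n i : ℕ}, X n i →+ X (n + 1) i
  -- each level is a graded-commutative graded ring
  add_mul : ∀ {n i j k : ℕ} (h : i + j = k) (x x' : X n i) (y : X n j),
    mul h (x + x') y = mul h x y + mul h x' y
  mul_add : ∀ {n i j k : ℕ} (h : i + j = k) (x : X n i) (y y' : X n j),
    mul h x (y + y') = mul h x y + mul h x y'
  one_mul : ∀ {n i : ℕ} (h : 0 + i = i) (x : X n i), mul h (one n) x = x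
  mul_assoc : ∀ {n i j k ij jk ijk : ℕ} (hij : i + j = ij) (hjk : j + k = jk)
    (h : ij + k = ijk) (h' : i + jk = ijk) (x : X n i) (y : X n j) (z : X n k),
    mul h (mul hij x y) z = mul h' x (mul hjk y z)
  mul_comm : ∀ {n i j k : ℕ} (h : i + j = k) (h' : j + i = k) (x : X n i) (y : X n j),
    mul h x y = ((-1 : ℤ) ^ (i * j)) • mul h' y x
  -- the differential
  d_d : ∀ {n i : ℕ} (x : X n i), d (d x) = 0
  d_mul : ∀ {n i j k : ℕ} (h : i + j = k) (h₁ : (i + 1) + j = k + 1) (h₂ : i + (j + 1) = k + 1)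
    (x : X n i) (y : X n j),
    d (mul h x y) = mul h₁ (d x) y + ((-1 : ℤ) ^ i) • mul h₂ x (d y)
  -- the structure map is a ring homomorphism
  lam_one : ∀ {n : ℕ}, lam (1 : TruncatedWittVector p n A) = one n
  lam_mul : ∀ {n : ℕ} (a b : TruncatedWittVector p n A),
    lam (a * b) = mul (Nat.add_zero 0) (lam a) (lam b)
  -- restriction is a homomorphism of differential graded rings, compatible with the structure map
  R_one : ∀ {n : ℕ}, R (one (n + 1)) = one n
  R_mul : ∀ {n i j k : ℕ} (h : i + j = k) (x : X (n + 1) i) (y : X (n + 1) j),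
    R (mul h x y) = mul h (R x) (R y)
  R_d : ∀ {n i : ℕ} (x : X (n + 1) i), R (d x) = d (R x)
  R_lam : ∀ {n : ℕ} (a : WittVector p A),
    R (lam (WittVector.truncate (n + 1) a)) = lam (WittVector.truncate n a)
  -- Frobenius is a homomorphism of graded rings, compatible with restriction and with the
  -- Frobenius `W_{n+1}(A) → W_n(A)` induced by that of `W(A)`
  F_one : ∀ {n : ℕ}, F (one (n + 1)) = one n
  F_mul : ∀ {n i j k : ℕ} (h : i + j = k) (x : X (n + 1) i) (y : X (n + 1) j),
    F (mul h x y) = mul h (F x) (F y)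
  R_F : ∀ {n i : ℕ} (x : X (n + 2) i), R (F x) = F (R x)
  F_lam : ∀ {n : ℕ} (a : WittVector p A),
    F (lam (WittVector.truncate (n + 1) a)) =
      lam (WittVector.truncate n (WittVector.frobenius a))
  /-- `F d [a] = [a]^(p-1) d [a]` -/
  F_d_teichmuller : ∀ {n : ℕ} (a : A),
    F (d (lam (WittVector.truncate (n + 1) (WittVector.teichmuller p a)))) =
      mul (Nat.zero_add 1) (lam (WittVector.truncate n (WittVector.teichmuller p a) ^ (p - 1)))
        (d (lam (WittVector.truncate n (WittVector.teichmuller p a))))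
  -- Verschiebung is compatible with restriction and with the Verschiebung `W_n(A) → W_{n+1}(A)`
  -- induced by that of `W(A)`
  R_V : ∀ {n i : ℕ} (x : X (n + 1) i), R (V x) = V (R x)
  V_lam : ∀ {n : ℕ} (a : WittVector p A),
    V (lam (WittVector.truncate n a)) =
      lam (WittVector.truncate (n + 1) (WittVector.verschiebung a))
  /-- Verschiebung is linear when its source is regarded as a module through Frobenius. -/
  V_F_mul : ∀ {n i j k : ℕ} (h : i + j = k) (x : X (n + 1) i) (y : X n j),
    V (mul h (F x) y) = mul h x (V y)
  F_d_V : ∀ {n i : ℕ} (x : X n i), F (d (V x)) = d x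
  F_V : ∀ {n i : ℕ} (x : X n i), F (V x) = p • x

namespace WittComplex

attribute [instance] WittComplex.addCommGroup

variable {p : ℕ} [Fact p.Prime] {A : Type u} [CommRing A]

/-- A morphism of Witt complexes: it respects all the structure. -/
@[ext]
structure Hom (E : WittComplex.{u, v} p A) (E' : WittComplex.{u, w} p A) where
  /-- the components -/
  f : ∀ {n i : ℕ}, E.X n i →+ E'.X n i
  map_one : ∀ {n : ℕ}, f (E.one n) = E'.one n
  map_mul : ∀ {n i j k : ℕ} (h : i + j = k) (x : E.X n i) (y : E.X n j),
    f (E.mul h x y) = E'.mul h (f x) (f y)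
  map_d : ∀ {n i : ℕ} (x : E.X n i), f (E.d x) = E'.d (f x)
  map_lam : ∀ {n : ℕ} (a : TruncatedWittVector p n A), f (E.lam a) = E'.lam a
  map_R : ∀ {n i : ℕ} (x : E.X (n + 1) i), f (E.R x) = E'.R (f x)
  map_F : ∀ {n i : ℕ} (x : E.X (n + 1) i), f (E.F x) = E'.F (f x)
  map_V : ∀ {n i : ℕ} (x : E.X n i), f (E.V x) = E'.V (f x)

/-! ### The initial Witt complex

It is built as for any equational theory: formal expressions in the operations, modulo the
equations that hold in every Witt complex. -/

/-- Formal expressions of level `n` and degree `i`. -/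
inductive Term (p : ℕ) (A : Type u) : ℕ → ℕ → Type u
  | lam {n : ℕ} : TruncatedWittVector p n A → Term p A n 0
  | one (n : ℕ) : Term p A n 0
  | zero (n i : ℕ) : Term p A n i
  | add {n i : ℕ} : Term p A n i → Term p A n i → Term p A n i
  | neg {n i : ℕ} : Term p A n i → Term p A n i
  | mul {n i j k : ℕ} : i + j = k → Term p A n i → Term p A n j → Term p A n k
  | d {n i : ℕ} : Term p A n i → Term p A n (i + 1)
  | R {n i : ℕ} : Term p A (n + 1) i → Term p A n i
  | F {n i : ℕ} : Term p A (n + 1) i → Term p A n i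
  | V {n i : ℕ} : Term p A n i → Term p A (n + 1) i

/-- The value of a formal expression in a Witt complex. -/
def eval (E : WittComplex.{u, v} p A) : ∀ {n i : ℕ}, Term p A n i → E.X n i
  | _, _, .lam a => E.lam a
  | _, _, .one n => E.one n
  | _, _, .zero _ _ => 0
  | _, _, .add x y => E.eval x + E.eval y
  | _, _, .neg x => -E.eval x
  | _, _, .mul h x y => E.mul h (E.eval x) (E.eval y)
  | _, _, .d x => E.d (E.eval x)
  | _, _, .R x => E.R (E.eval x)
  | _, _, .F x => E.F (E.eval x)
  | _, _, .V x => E.V (E.eval x)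

section TermQuotient

variable {ι : Type w} (E : ι → WittComplex.{u, v} p A)

/-- Two expressions are identified if they have the same value in every member of the family. -/
def termSetoid (n i : ℕ) : Setoid (Term p A n i) where
  r x y := ∀ s, (E s).eval x = (E s).eval y
  iseqv := ⟨fun _ _ => rfl, fun h s => (h s).symm, fun h h' s => (h s).trans (h' s)⟩

/-- Formal expressions modulo the equations that hold in every member of the family `E`. -/
def TermQuotient (n i : ℕ) : Type u := Quotient (termSetoid E n i)

instance (n i : ℕ) : Zero (TermQuotient E n i) := ⟨Quotient.mk _ (.zero n i)⟩

instance (n i : ℕ) : Add (TermQuotient E n i) :=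
  ⟨Quotient.map₂ .add fun _ _ h _ _ h' s => congrArg₂ (· + ·) (h s) (h' s)⟩

instance (n i : ℕ) : Neg (TermQuotient E n i) :=
  ⟨Quotient.map .neg fun _ _ h s => congrArg (- ·) (h s)⟩

instance (n i : ℕ) : AddCommGroup (TermQuotient E n i) where
  add_assoc := by
    rintro ⟨x⟩ ⟨y⟩ ⟨z⟩; exact Quotient.sound fun s => add_assoc _ _ _
  zero_add := by
    rintro ⟨x⟩; exact Quotient.sound fun s => zero_add _
  add_zero := by
    rintro ⟨x⟩; exact Quotient.sound fun s => add_zero _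
  neg_add_cancel := by
    rintro ⟨x⟩; exact Quotient.sound fun s => neg_add_cancel _
  add_comm := by
    rintro ⟨x⟩ ⟨y⟩; exact Quotient.sound fun s => add_comm _ _
  nsmul := nsmulRec
  zsmul := zsmulRec

/-- The class of an expression. -/
def mkTerm {n i : ℕ} (x : Term p A n i) : TermQuotient E n i := Quotient.mk _ x

/-- The value of a class of expressions in a member of the family. -/
def evalQuotient (s : ι) {n i : ℕ} : TermQuotient E n i →+ (E s).X n i :=
  AddMonoidHom.mk' (Quotient.lift (E s).eval fun _ _ h => h s) (by rintro ⟨x⟩ ⟨y⟩; rfl)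

theorem termQuotient_ext {n i : ℕ} {x y : TermQuotient E n i}
    (h : ∀ s, evalQuotient E s x = evalQuotient E s y) : x = y := by
  induction x using Quotient.inductionOn with | _ x
  induction y using Quotient.inductionOn with | _ y
  exact Quotient.sound h

/-- The Witt complex of formal expressions modulo the equations that hold in every member
of the family `E`. -/
def termQuotient : WittComplex.{u, u} p A where
  X := TermQuotient E
  one n := Quotient.mk _ (.one n)
  mul h := Quotient.map₂ (.mul h) fun _ _ e _ _ e' s => congrArg₂ ((E s).mul h) (e s) (e' s)
  d := AddMonoidHom.mk' (Quotient.map .d fun _ _ e s => congrArg (E s).d (e s)) (by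
    rintro ⟨x⟩ ⟨y⟩; exact Quotient.sound fun s => map_add (E s).d _ _)
  lam := AddMonoidHom.mk' (fun a => Quotient.mk _ (.lam a)) fun a b =>
    Quotient.sound fun s => map_add (E s).lam a b
  R := AddMonoidHom.mk' (Quotient.map .R fun _ _ e s => congrArg (E s).R (e s)) (by
    rintro ⟨x⟩ ⟨y⟩; exact Quotient.sound fun s => map_add (E s).R _ _)
  F := AddMonoidHom.mk' (Quotient.map .F fun _ _ e s => congrArg (E s).F (e s)) (by
    rintro ⟨x⟩ ⟨y⟩; exact Quotient.sound fun s => map_add (E s).F _ _)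
  V := AddMonoidHom.mk' (Quotient.map .V fun _ _ e s => congrArg (E s).V (e s)) (by
    rintro ⟨x⟩ ⟨y⟩; exact Quotient.sound fun s => map_add (E s).V _ _)
  add_mul := by
    rintro _ _ _ _ h ⟨x⟩ ⟨y⟩ ⟨z⟩; exact Quotient.sound fun s => (E s).add_mul h _ _ _
  mul_add := by
    rintro _ _ _ _ h ⟨x⟩ ⟨y⟩ ⟨z⟩; exact Quotient.sound fun s => (E s).mul_add h _ _ _
  one_mul := by
    rintro _ _ h ⟨x⟩; exact Quotient.sound fun s => (E s).one_mul h _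
  mul_assoc := by
    rintro _ _ _ _ _ _ _ h₁ h₂ h₃ h₄ ⟨x⟩ ⟨y⟩ ⟨z⟩
    exact Quotient.sound fun s => (E s).mul_assoc h₁ h₂ h₃ h₄ _ _ _
  mul_comm := by
    rintro _ _ _ _ h h' ⟨x⟩ ⟨y⟩
    refine termQuotient_ext E fun s => ?_
    exact ((E s).mul_comm h h' _ _).trans
      (map_zsmul (evalQuotient E s) _ (mkTerm E (.mul h' y x))).symm
  d_d := by
    rintro _ _ ⟨x⟩; exact Quotient.sound fun s => (E s).d_d _
  d_mul := by
    rintro _ _ _ _ h h₁ h₂ ⟨x⟩ ⟨y⟩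
    refine termQuotient_ext E fun s => ?_
    refine ((E s).d_mul h h₁ h₂ _ _).trans ?_
    refine Eq.trans ?_ (map_add (evalQuotient E s) _ _).symm
    exact congrArg₂ (· + ·) rfl
      (map_zsmul (evalQuotient E s) _ (mkTerm E (.mul h₂ x (.d y)))).symm
  lam_one := Quotient.sound fun s => (E s).lam_one
  lam_mul a b := Quotient.sound fun s => (E s).lam_mul a b
  R_one := Quotient.sound fun s => (E s).R_one
  R_mul := by
    rintro _ _ _ _ h ⟨x⟩ ⟨y⟩; exact Quotient.sound fun s => (E s).R_mul h _ _
  R_d := by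
    rintro _ _ ⟨x⟩; exact Quotient.sound fun s => (E s).R_d _
  R_lam a := Quotient.sound fun s => (E s).R_lam a
  F_one := Quotient.sound fun s => (E s).F_one
  F_mul := by
    rintro _ _ _ _ h ⟨x⟩ ⟨y⟩; exact Quotient.sound fun s => (E s).F_mul h _ _
  R_F := by
    rintro _ _ ⟨x⟩; exact Quotient.sound fun s => (E s).R_F _
  F_lam a := Quotient.sound fun s => (E s).F_lam a
  F_d_teichmuller a := Quotient.sound fun s => (E s).F_d_teichmuller a
  R_V := by
    rintro _ _ ⟨x⟩; exact Quotient.sound fun s => (E s).R_V _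
  V_lam a := Quotient.sound fun s => (E s).V_lam a
  V_F_mul := by
    rintro _ _ _ _ h ⟨x⟩ ⟨y⟩; exact Quotient.sound fun s => (E s).V_F_mul h _ _
  F_d_V := by
    rintro _ _ ⟨x⟩; exact Quotient.sound fun s => (E s).F_d_V _
  F_V := by
    rintro _ _ ⟨x⟩
    refine termQuotient_ext E fun s => ?_
    exact ((E s).F_V _).trans (map_nsmul (evalQuotient E s) _ (mkTerm E x)).symm

/-- Evaluation is a morphism to each member of the family. -/
def termQuotientHom (s : ι) : Hom (termQuotient E) (E s) where
  f := evalQuotient E s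
  map_one := rfl
  map_mul := by rintro _ _ _ _ h ⟨x⟩ ⟨y⟩; rfl
  map_d := by rintro _ _ ⟨x⟩; rfl
  map_lam _ := rfl
  map_R := by rintro _ _ ⟨x⟩; rfl
  map_F := by rintro _ _ ⟨x⟩; rfl
  map_V := by rintro _ _ ⟨x⟩; rfl

end TermQuotient

end WittComplex

/-- The absolute `p`-typical de Rham–Witt complex of `A`: the initial Witt complex over `A`
(see `deRhamWitt_initial`).  The group `W_n Ω^i_A` is `(deRhamWitt p A).X n i`. -/
def deRhamWitt (p : ℕ) [Fact p.Prime] (A : Type u) [CommRing A] : WittComplex.{u, u} p A :=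
  WittComplex.termQuotient fun E : WittComplex.{u, u} p A => E

/-- The de Rham–Witt complex has exactly one morphism to every Witt complex, in any universe. -/
theorem deRhamWitt_initial (p : ℕ) [Fact p.Prime] (A : Type u) [CommRing A]
    (E : WittComplex.{u, v} p A) : Nonempty (Unique (WittComplex.Hom (deRhamWitt p A) E)) := by
  let g := WittComplex.termQuotientHom (fun E : WittComplex.{u, u} p A => E)
    (WittComplex.termQuotient fun _ : Unit => E)
  let g' := WittComplex.termQuotientHom (fun _ : Unit => E) ()
  refine ⟨⟨⟨⟨g'.f.comp g.f, ?_, ?_, ?_, ?_, ?_, ?_, ?_⟩⟩, fun f => ?_⟩⟩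
  · intro n; exact (congrArg g'.f (g.map_one (n := n))).trans g'.map_one
  · intros; exact (congrArg g'.f (g.map_mul _ _ _)).trans (g'.map_mul _ _ _)
  · intros; exact (congrArg g'.f (g.map_d _)).trans (g'.map_d _)
  · intro n a; exact (congrArg g'.f (g.map_lam a)).trans (g'.map_lam a)
  · intros; exact (congrArg g'.f (g.map_R _)).trans (g'.map_R _)
  · intros; exact (congrArg g'.f (g.map_F _)).trans (g'.map_F _)
  · intros; exact (congrArg g'.f (g.map_V _)).trans (g'.map_V _)
  · have key : ∀ (f : WittComplex.Hom (deRhamWitt p A) E) {n i : ℕ}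
        (x : WittComplex.Term p A n i), f.f (Quotient.mk _ x) = E.eval x := by
      intro f n i x
      induction x with
      | lam a => exact f.map_lam a
      | one n => exact f.map_one
      | zero n i => exact map_zero f.f
      | add x y hx hy => exact (map_add f.f _ _).trans (congrArg₂ (· + ·) hx hy)
      | neg x hx => exact (map_neg f.f _).trans (congrArg (- ·) hx)
      | mul h x y hx hy => exact (f.map_mul h _ _).trans (congrArg₂ (E.mul h) hx hy)
      | d x hx => exact (f.map_d _).trans (congrArg E.d hx)
      | R x hx => exact (f.map_R _).trans (congrArg E.R hx)
      | F x hx => exact (f.map_F _).trans (congrArg E.F hx)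
      | V x hx => exact (f.map_V _).trans (congrArg E.V hx)
    apply WittComplex.Hom.ext
    funext n i
    ext ⟨x⟩
    exact (key f x).trans (key _ x).symm

namespace WittComplex

variable {p : ℕ} [Fact p.Prime] {A : Type u} [CommRing A]

/-- The isomorphism `A → W_1(A)`, as a ring homomorphism. -/
def toWittOne (p : ℕ) [Fact p.Prime] (A : Type u) [CommRing A] :
    A →+* TruncatedWittVector p 1 A :=
  have key : ∀ w : WittVector p A,
      TruncatedWittVector.mk p (fun _ => WittVector.constantCoeff w) =
        WittVector.truncate 1 w := fun w => by
    ext i; rw [Subsingleton.elim i 0]; simp [WittVector.constantCoeff]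
  have hc : ∀ a : A, WittVector.constantCoeff (WittVector.teichmuller p a) = a := fun a =>
    WittVector.teichmuller_coeff_zero p a
  { toFun := fun a => TruncatedWittVector.mk p fun _ => a
    map_one' := by rw [← map_one (WittVector.truncate 1), ← key, map_one]
    map_zero' := by rw [← map_zero (WittVector.truncate 1), ← key, map_zero]
    map_mul' := fun a b => by
      conv_lhs => rw [← hc a, ← hc b, ← map_mul, key, map_mul, ← key, ← key, hc, hc]
    map_add' := fun a b => by
      conv_lhs => rw [← hc a, ← hc b, ← map_add, key, map_add, ← key, ← key, hc, hc] }

variable (E : WittComplex.{u, v} p A)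

/-- The `A`-module structure on the pieces of level one, through `A ≅ W_1(A)`. -/
@[reducible]
def moduleOne (i : ℕ) : Module A (E.X 1 i) where
  smul a x := E.mul (Nat.zero_add i) (E.lam (toWittOne p A a)) x
  one_smul x := by
    change E.mul _ (E.lam (toWittOne p A 1)) x = x
    rw [map_one, E.lam_one, E.one_mul]
  mul_smul a b x := by
    change E.mul _ (E.lam (toWittOne p A (a * b))) x = E.mul _ _ (E.mul _ _ x)
    rw [map_mul, E.lam_mul]
    exact E.mul_assoc _ _ _ _ _ _ _
  smul_zero a := by
    have h := E.mul_add (Nat.zero_add i) (E.lam (toWittOne p A a)) 0 0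
    rw [add_zero] at h
    exact left_eq_add.mp h
  smul_add a x y := E.mul_add _ _ _ _
  add_smul a b x := by
    change E.mul _ (E.lam (toWittOne p A (a + b))) x = _
    rw [map_add, map_add, E.add_mul]; rfl
  zero_smul x := by
    change E.mul _ (E.lam (toWittOne p A 0)) x = 0
    have h := E.add_mul (Nat.zero_add i) 0 0 x
    rw [add_zero] at h
    rw [map_zero, map_zero]
    exact left_eq_add.mp h

/-- The canonical map `Ω^1_A → X 1 1`, `a db ↦ λ(a) dλ(b)`, from the absolute Kähler
differentials, given by the universal property of the latter. -/
def ofKaehler : Ω[A⁄ℤ] →+ E.X 1 1 :=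
  letI := E.moduleOne 1
  ((Derivation.mk'
    ((E.d.comp (E.lam.comp (toWittOne p A).toAddMonoidHom)).toIntLinearMap)
    (fun a b => by
      change E.d (E.lam (toWittOne p A (a * b))) =
        E.mul _ (E.lam (toWittOne p A a)) (E.d (E.lam (toWittOne p A b))) +
        E.mul _ (E.lam (toWittOne p A b)) (E.d (E.lam (toWittOne p A a)))
      rw [map_mul, E.lam_mul, E.d_mul _ (Nat.add_zero 1) (Nat.zero_add 1), pow_zero, one_smul]
      refine (add_comm _ _).trans (congrArg₂ (· + ·) rfl ?_)
      rw [E.mul_comm _ (Nat.zero_add 1), mul_zero, pow_zero, one_smul]) :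
      Derivation ℤ A (E.X 1 1)).liftKaehlerDifferential).toAddMonoidHom

/-- The iterated Verschiebung `V^(k-n)` from level `n` to level `k`, for `n ≤ k`. -/
def VIter {n k i : ℕ} (h : n ≤ k) (x : E.X n i) : E.X k i :=
  Nat.leRecOn (C := fun l => E.X l i) h (fun {_} => E.V) x

/-- The map `(-d, p^n) : A → Ω^1_A ⊕ A`. -/
def sequenceLeft (p : ℕ) (A : Type u) [CommRing A] (n : ℕ) (a : A) : Ω[A⁄ℤ] × A :=
  (-KaehlerDifferential.D ℤ A a, (p : A) ^ n * a)

/-- The map `V^n ⊕ dV^n : Ω^1_A ⊕ A → W_{n+1} Ω^1_A`, `(α, a) ↦ V^n(α) + dV^n(a)`, where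
`Ω^1_A` and `A = W_1(A)` are mapped to level one. -/
def sequenceMiddle (n : ℕ) (x : Ω[A⁄ℤ] × A) : E.X (n + 1) 1 :=
  E.VIter (Nat.le_add_left 1 n) (E.ofKaehler x.1) +
    E.d (E.VIter (Nat.le_add_left 1 n) (E.lam (toWittOne p A x.2)))

/-- Exactness of
`0 → A → Ω^1_A ⊕ A → W_{n+1} Ω^1_A → W_n Ω^1_A → 0`, with maps `(-d, p^n)`, `V^n ⊕ dV^n`, `R`. -/
structure IsSequenceExact (n : ℕ) : Prop where
  injective : Function.Injective (sequenceLeft p A n)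
  exact_left : Function.Exact (sequenceLeft p A n) (E.sequenceMiddle n)
  exact_right : Function.Exact (E.sequenceMiddle n) (E.R : E.X (n + 1) 1 →+ E.X n 1)
  surjective : Function.Surjective (E.R : E.X (n + 1) 1 →+ E.X n 1)

end WittComplex

end

/-! It suffices that a single `V` is injective in degree one at every level `n + 1`, and this goes
by induction on `n`. If `V x = 0`, then `V (R x) = R (V x) = 0`, so `R x = 0` by induction, and
exactness gives `x = V^n(α) + dV^n(a)`. Since `V d = p d V` (`V_d`), `V x = V^(n+1)(α) +
dV^(n+1)(pa)` (`V_sequenceMiddle`). Exactness one level up yields `b` with `α = -db` and `pa =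
p^(n+1) b`. As `A` is `p`-torsion-free, `a = p^n b`, so `(α, a)` comes from `b` and `x = 0`
(`sequenceMiddle_eq_zero_of_V`).

At level one the same argument runs with `n = 0`, provided that `Ω^1_A` surjects onto `W_1 Ω^1_A`.
This holds because the sums of `λ(x) dλ(y)` fill the degree one part of the initial Witt complex:
together with `λ(W_n(A))` in degree zero they are stable under all the operations
(`deRhamWitt_generated`). -/

theorem WittVector.exists_teichmuller_add_verschiebung {p : ℕ} [Fact p.Prime] {A : Type*}
    [CommRing A] (w : WittVector p A) :
    ∃ (a : A) (w' : WittVector p A), w = teichmuller p a + verschiebung w' := by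
  have h0 : (w - teichmuller p (w.coeff 0)).coeff 0 = 0 := by
    change constantCoeff (w - teichmuller p (w.coeff 0)) = 0
    rw [map_sub]
    change w.coeff 0 - (teichmuller p (w.coeff 0)).coeff 0 = 0
    rw [teichmuller_coeff_zero, sub_self]
  have h := eq_iterate_verschiebung (x := w - teichmuller p (w.coeff 0)) (n := 1) fun i hi => by
    rwa [Nat.lt_one_iff.mp hi]
  exact ⟨w.coeff 0, _, (sub_eq_iff_eq_add'.mp h)⟩

/-! ### Identities in a Witt complex -/

namespace WittComplex

variable {p : ℕ} [Fact p.Prime] {A : Type u} [CommRing A] (E : WittComplex.{u, v} p A)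

theorem zero_mul {n i j k : ℕ} (h : i + j = k) (y : E.X n j) : E.mul h (0 : E.X n i) y = 0 := by
  have := E.add_mul h 0 0 y
  rw [add_zero] at this
  exact left_eq_add.mp this

theorem mul_comm_zero_one {n : ℕ} (h : 0 + 1 = 1) (h' : 1 + 0 = 1) (x : E.X n 0) (y : E.X n 1) :
    E.mul h x y = E.mul h' y x := by
  rw [E.mul_comm h h', Nat.zero_mul, pow_zero, one_smul]

theorem d_one {n : ℕ} : E.d (E.one n) = 0 := by
  have h := E.d_mul (Nat.zero_add 0) (Nat.add_zero 1) (Nat.zero_add 1) (E.one n) (E.one n)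
  rw [E.one_mul, pow_zero, one_smul, ← E.mul_comm_zero_one (Nat.zero_add 1), E.one_mul] at h
  exact left_eq_add.mp h

/-- `V d = p d V` in degree zero. -/
theorem V_d {n : ℕ} (x : E.X n 0) : E.V (E.d x) = p • E.d (E.V x) := by
  -- Apply the Leibniz rule to `V(1) V(x) = p V(x)`. By the projection formula, `V(1) dV(x) = V(F
  -- dV(x)) = V(dx)`, while the other term is `V(d1 · x) = 0`.
  have h1 : E.V (E.d x) = E.mul (Nat.zero_add 1) (E.V (E.one n)) (E.d (E.V x)) := by
    rw [E.mul_comm_zero_one _ (Nat.add_zero 1), ← E.V_F_mul, E.F_d_V,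
      ← E.mul_comm_zero_one (Nat.zero_add 1), E.one_mul]
  have h2 : E.mul (Nat.zero_add 0) (E.V (E.one n)) (E.V x) = p • E.V x := by
    rw [← E.V_F_mul, E.F_V, ← map_nsmul]
    congr 1
    have : ∀ k : ℕ, E.mul (Nat.zero_add 0) (k • E.one n) x = k • x := by
      intro k
      induction k with
      | zero => rw [zero_smul, zero_smul, E.zero_mul]
      | succ k ih => rw [succ_nsmul, succ_nsmul, E.add_mul, ih, E.one_mul]
    exact this p
  have h3 : E.mul (Nat.add_zero 1) (E.d (E.V (E.one n))) (E.V x) = 0 := by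
    rw [← E.V_F_mul, E.F_d_V, E.d_one, E.zero_mul, map_zero]
  have h4 := E.d_mul (Nat.zero_add 0) (Nat.add_zero 1) (Nat.zero_add 1) (E.V (E.one n)) (E.V x)
  rw [h2, h3, pow_zero, one_smul, ← h1] at h4
  exact ((map_nsmul E.d p (E.V x)).symm.trans (h4.trans (zero_add _))).symm

/-! ### The part generated by the Witt vectors in degrees zero and one -/

/-- The elements `λ(x)` in degree zero, the sums of elements `λ(x) dλ(y)` in degree one, and
everything in higher degrees. -/
noncomputable def generated (n : ℕ) : ∀ i : ℕ, AddSubgroup (E.X n i)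
  | 0 => E.lam.range
  | 1 => AddSubgroup.closure
      {z | ∃ x y : TruncatedWittVector p n A,
        E.mul (Nat.zero_add 1) (E.lam x) (E.d (E.lam y)) = z}
  -- Only degrees zero and one matter; taking everything above them makes closure under `d` and
  -- products automatic there.
  | _ + 2 => ⊤

variable {E}

theorem lam_mem_generated {n : ℕ} (x : TruncatedWittVector p n A) : E.lam x ∈ E.generated n 0 :=
  ⟨x, rfl⟩

theorem mul_d_mem_generated {n : ℕ} (x y : TruncatedWittVector p n A) :
    E.mul (Nat.zero_add 1) (E.lam x) (E.d (E.lam y)) ∈ E.generated n 1 :=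
  AddSubgroup.subset_closure ⟨x, y, rfl⟩

theorem d_lam_mem_generated {n : ℕ} (y : TruncatedWittVector p n A) :
    E.d (E.lam y) ∈ E.generated n 1 := by
  have := mul_d_mem_generated (E := E) 1 y
  rwa [E.lam_one, E.one_mul] at this

theorem map_mem_of_mem_generated_one {n : ℕ} {G : Type*} [AddCommGroup G] (f : E.X n 1 →+ G)
    (S : AddSubgroup G)
    (h : ∀ x y : TruncatedWittVector p n A,
      f (E.mul (Nat.zero_add 1) (E.lam x) (E.d (E.lam y))) ∈ S)
    {z : E.X n 1} (hz : z ∈ E.generated n 1) : f z ∈ S := by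
  have : E.generated n 1 ≤ S.comap f := by
    refine (AddSubgroup.closure_le _).mpr ?_
    rintro _ ⟨x, y, rfl⟩
    exact h x y
  exact this hz

theorem lam_mul_mem_generated {n : ℕ} (h : 0 + 1 = 1) (x : TruncatedWittVector p n A)
    {z : E.X n 1} (hz : z ∈ E.generated n 1) : E.mul h (E.lam x) z ∈ E.generated n 1 := by
  refine map_mem_of_mem_generated_one (AddMonoidHom.mk' (E.mul h (E.lam x)) (E.mul_add h _))
    _ (fun a b => ?_) hz
  change E.mul h (E.lam x) (E.mul _ (E.lam a) (E.d (E.lam b))) ∈ _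
  rw [← E.mul_assoc (Nat.add_zero 0) (Nat.zero_add 1) (Nat.zero_add 1), ← E.lam_mul]
  exact mul_d_mem_generated _ _

theorem mul_mem_generated {n i j k : ℕ} (h : i + j = k) {x : E.X n i} {y : E.X n j}
    (hx : x ∈ E.generated n i) (hy : y ∈ E.generated n j) : E.mul h x y ∈ E.generated n k := by
  match k with
  | _ + 2 => exact AddSubgroup.mem_top _
  | 0 =>
    obtain ⟨rfl, rfl⟩ := Nat.add_eq_zero_iff.mp h
    obtain ⟨a, rfl⟩ := hx
    obtain ⟨b, rfl⟩ := hy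
    exact ⟨a * b, E.lam_mul a b⟩
  | 1 =>
    obtain ⟨rfl, rfl⟩ | ⟨rfl, rfl⟩ := Nat.add_eq_one_iff.mp h
    · obtain ⟨a, rfl⟩ := hx
      exact lam_mul_mem_generated h a hy
    · obtain ⟨a, rfl⟩ := hy
      rw [← E.mul_comm_zero_one (Nat.zero_add 1)]
      exact lam_mul_mem_generated _ a hx

theorem d_mem_generated {n i : ℕ} {x : E.X n i} (hx : x ∈ E.generated n i) :
    E.d x ∈ E.generated n (i + 1) := by
  match i with
  | 0 =>
    obtain ⟨a, rfl⟩ := hx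
    exact d_lam_mem_generated a
  | _ + 1 => exact AddSubgroup.mem_top _

theorem R_lam_mem_generated {n : ℕ} (x : TruncatedWittVector p (n + 1) A) :
    E.R (E.lam x) ∈ E.generated n 0 := by
  obtain ⟨a, rfl⟩ := WittVector.truncate_surjective p (n + 1) A x
  rw [E.R_lam]
  exact lam_mem_generated _

theorem F_lam_mem_generated {n : ℕ} (x : TruncatedWittVector p (n + 1) A) :
    E.F (E.lam x) ∈ E.generated n 0 := by
  obtain ⟨a, rfl⟩ := WittVector.truncate_surjective p (n + 1) A x
  rw [E.F_lam]
  exact lam_mem_generated _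

theorem V_lam_mem_generated {n : ℕ} (x : TruncatedWittVector p n A) :
    E.V (E.lam x) ∈ E.generated (n + 1) 0 := by
  obtain ⟨a, rfl⟩ := WittVector.truncate_surjective p n A x
  rw [E.V_lam]
  exact lam_mem_generated _

/-- Writing a Witt vector as `[a] + V(w')` reduces to the two axioms that compute `F d`: `F d[a] =
[a]^(p-1) d[a]` and `F d V = d`. -/
theorem F_d_lam_mem_generated {n : ℕ} (x : TruncatedWittVector p (n + 1) A) :
    E.F (E.d (E.lam x)) ∈ E.generated n 1 := by
  obtain ⟨w, rfl⟩ := WittVector.truncate_surjective p (n + 1) A x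
  obtain ⟨a, w', rfl⟩ := w.exists_teichmuller_add_verschiebung
  rw [map_add, map_add, map_add, map_add, E.F_d_teichmuller, ← E.V_lam, E.F_d_V]
  exact add_mem (mul_d_mem_generated _ _) (d_lam_mem_generated _)

theorem R_mem_generated {n i : ℕ} {x : E.X (n + 1) i} (hx : x ∈ E.generated (n + 1) i) :
    E.R x ∈ E.generated n i := by
  match i with
  | 0 =>
    obtain ⟨a, rfl⟩ := hx
    exact R_lam_mem_generated a
  | 1 =>
    refine map_mem_of_mem_generated_one E.R _ (fun a b => ?_) hx
    rw [E.R_mul, E.R_d]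
    exact mul_mem_generated _ (R_lam_mem_generated a) (d_mem_generated (R_lam_mem_generated b))
  | _ + 2 => exact AddSubgroup.mem_top _

theorem F_mem_generated {n i : ℕ} {x : E.X (n + 1) i} (hx : x ∈ E.generated (n + 1) i) :
    E.F x ∈ E.generated n i := by
  match i with
  | 0 =>
    obtain ⟨a, rfl⟩ := hx
    exact F_lam_mem_generated a
  | 1 =>
    refine map_mem_of_mem_generated_one E.F _ (fun a b => ?_) hx
    rw [E.F_mul]
    exact mul_mem_generated _ (F_lam_mem_generated a) (F_d_lam_mem_generated b)
  | _ + 2 => exact AddSubgroup.mem_top _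

theorem V_mem_generated {n i : ℕ} {x : E.X n i} (hx : x ∈ E.generated n i) :
    E.V x ∈ E.generated (n + 1) i := by
  match i with
  | 0 =>
    obtain ⟨a, rfl⟩ := hx
    exact V_lam_mem_generated a
  | 1 =>
    refine map_mem_of_mem_generated_one E.V _ (fun a b => ?_) hx
    -- Replacing `dλ(b)` by `F dV λ(b)` lets the projection formula pull it out of `V`.
    have h : E.V (E.mul (Nat.zero_add 1) (E.lam a) (E.d (E.lam b))) =
        E.mul (Nat.zero_add 1) (E.V (E.lam a)) (E.d (E.V (E.lam b))) := by
      rw [E.mul_comm_zero_one _ (Nat.add_zero 1), ← E.F_d_V, E.V_F_mul,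
        ← E.mul_comm_zero_one (Nat.zero_add 1)]
    rw [h]
    exact mul_mem_generated _ (V_lam_mem_generated a) (d_mem_generated (V_lam_mem_generated b))
  | _ + 2 => exact AddSubgroup.mem_top _

theorem eval_mem_generated {n i : ℕ} (x : Term p A n i) : E.eval x ∈ E.generated n i := by
  induction x with
  | lam a => exact lam_mem_generated a
  | one n => exact ⟨1, E.lam_one⟩
  | zero n i => exact zero_mem _
  | add x y hx hy => exact add_mem hx hy
  | neg x hx => exact neg_mem hx
  | mul h x y hx hy => exact mul_mem_generated h hx hy
  | d x hx => exact d_mem_generated hx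
  | R x hx => exact R_mem_generated hx
  | F x hx => exact F_mem_generated hx
  | V x hx => exact V_mem_generated hx

variable (E)

/-! ### Level one, iterated Verschiebung and the middle map -/

theorem ofKaehler_smul_D (a b : A) :
    E.ofKaehler (a • KaehlerDifferential.D ℤ A b) =
      E.mul (Nat.zero_add 1) (E.lam (toWittOne p A a)) (E.d (E.lam (toWittOne p A b))) := by
  let := E.moduleOne 1
  change Derivation.liftKaehlerDifferential _ (a • KaehlerDifferential.D ℤ A b) = _
  rw [map_smul, Derivation.liftKaehlerDifferential_comp_D]
  rfl

theorem toWittOne_surjective : Function.Surjective (toWittOne p A) := by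
  intro x
  refine ⟨x.coeff 0, ?_⟩
  ext i
  rw [Subsingleton.elim i 0]
  rfl

theorem generated_one_le_range_ofKaehler : E.generated 1 1 ≤ E.ofKaehler.range := by
  refine (AddSubgroup.closure_le _).mpr ?_
  rintro _ ⟨x, y, rfl⟩
  obtain ⟨a, rfl⟩ := toWittOne_surjective x
  obtain ⟨b, rfl⟩ := toWittOne_surjective y
  exact ⟨_, E.ofKaehler_smul_D a b⟩

theorem VIter_self {n i : ℕ} (h : n ≤ n) (x : E.X n i) : E.VIter h x = x :=
  Nat.leRecOn_self (C := fun l => E.X l i) x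

theorem VIter_succ {n k i : ℕ} (h : n ≤ k + 1) (h' : n ≤ k) (x : E.X n i) :
    E.VIter h x = E.V (E.VIter h' x) :=
  Nat.leRecOn_succ (C := fun l => E.X l i) h' x

theorem VIter_nsmul {n k i : ℕ} (h : n ≤ k) (c : ℕ) (x : E.X n i) :
    E.VIter h (c • x) = c • E.VIter h x := by
  induction k, h using Nat.le_induction with
  | base => rw [VIter_self, VIter_self]
  | succ k h ih => rw [E.VIter_succ _ h, E.VIter_succ _ h, ih, map_nsmul]

/-- The factor `p` on the second component is the one in `V d = p d V`. -/
theorem V_sequenceMiddle (n : ℕ) (α : Ω[A⁄ℤ]) (a : A) :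
    E.V (E.sequenceMiddle n (α, a)) = E.sequenceMiddle (n + 1) (α, p * a) := by
  rw [sequenceMiddle, sequenceMiddle, map_add, E.V_d,
    E.VIter_succ (k := n + 1) _ (Nat.le_add_left 1 n),
    E.VIter_succ (k := n + 1) _ (Nat.le_add_left 1 n)]
  congr 1
  rw [← nsmul_eq_mul, map_nsmul, map_nsmul, VIter_nsmul, map_nsmul, map_nsmul]

end WittComplex

open WittComplex

/-- A formal expression evaluated in the term quotient is its own class, so every element is the
value of an expression, and such values are generated. -/
theorem deRhamWitt_generated (p : ℕ) [Fact p.Prime] (A : Type u) [CommRing A] {n i : ℕ}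
    (x : (deRhamWitt p A).X n i) : x ∈ (deRhamWitt p A).generated n i := by
  have key : ∀ {n i : ℕ} (t : Term p A n i),
      (deRhamWitt p A).eval t = mkTerm (fun E : WittComplex.{u, u} p A => E) t := by
    intro n i t
    induction t with
    | lam a => rfl
    | one n => rfl
    | zero n i => rfl
    | add x y hx hy => exact congrArg₂ (· + ·) hx hy
    | neg x hx => exact congrArg (- ·) hx
    | mul h x y hx hy => exact congrArg₂ ((deRhamWitt p A).mul h) hx hy
    | d x hx => exact congrArg (deRhamWitt p A).d hx
    | R x hx => exact congrArg (deRhamWitt p A).R hx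
    | F x hx => exact congrArg (deRhamWitt p A).F hx
    | V x hx => exact congrArg (deRhamWitt p A).V hx
  obtain ⟨t, rfl⟩ : ∃ t, mkTerm (fun E : WittComplex.{u, u} p A => E) t = x :=
    Quotient.exists_rep x
  rw [← key]
  exact eval_mem_generated t

theorem deRhamWitt_ofKaehler_surjective (p : ℕ) [Fact p.Prime] (A : Type u) [CommRing A] :
    Function.Surjective (deRhamWitt p A).ofKaehler := fun x =>
  (deRhamWitt p A).generated_one_le_range_ofKaehler (deRhamWitt_generated p A x)

/-! ### Injectivity of `V` in degree one -/

namespace WittComplex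

variable {p : ℕ} [Fact p.Prime] {A : Type u} [CommRing A] {E : WittComplex.{u, v} p A}

/-- An element `V^n(α) + dV^n(a)` killed by `V` vanishes. -/
theorem sequenceMiddle_eq_zero_of_V {n : ℕ} (hA : ∀ a : A, (p : A) * a = 0 → a = 0)
    (hn : E.sequenceMiddle n ∘ sequenceLeft p A n = 0)
    (hexact : Function.Exact (sequenceLeft p A (n + 1)) (E.sequenceMiddle (n + 1)))
    {α : Ω[A⁄ℤ]} {a : A} (h : E.V (E.sequenceMiddle n (α, a)) = 0) :
    E.sequenceMiddle n (α, a) = 0 := by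
  rw [V_sequenceMiddle] at h
  obtain ⟨b, hb⟩ := (hexact _).mp h
  obtain ⟨h1, h2⟩ := Prod.ext_iff.mp hb
  -- Cancel one `p` from `p^(n+1) b = p a`; this is where torsion-freeness enters.
  have ha : (p : A) ^ n * b = a := by
    refine sub_eq_zero.mp (hA _ ?_)
    change (p : A) ^ (n + 1) * b = p * a at h2
    rw [mul_sub, ← h2]
    ring
  rw [show (α, a) = sequenceLeft p A n b from Prod.ext h1.symm ha.symm]
  exact congrFun hn b

/-- At `n = 0` the sequence is a complex. -/
theorem sequenceMiddle_zero_comp_sequenceLeft :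
    E.sequenceMiddle 0 ∘ sequenceLeft p A 0 = 0 := by
  funext b
  have hD : E.ofKaehler (KaehlerDifferential.D ℤ A b) = E.d (E.lam (toWittOne p A b)) := by
    have := E.ofKaehler_smul_D 1 b
    rwa [one_smul, map_one, E.lam_one, E.one_mul] at this
  change E.VIter _ (E.ofKaehler (-KaehlerDifferential.D ℤ A b)) +
    E.d (E.VIter _ (E.lam (toWittOne p A ((p : A) ^ 0 * b)))) = 0
  rw [VIter_self, VIter_self, pow_zero, _root_.one_mul, map_neg, hD, neg_add_cancel]

theorem eq_zero_of_V_eq_zero (hA : ∀ a : A, (p : A) * a = 0 → a = 0)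
    (hE : Function.Surjective E.ofKaehler) (hexact : ∀ n : ℕ, 1 ≤ n → E.IsSequenceExact n)
    (n : ℕ) {x : E.X (n + 1) 1} (hx : E.V x = 0) : x = 0 := by
  induction n with
  | zero =>
    -- No exact sequence is assumed for `n = 0`; surjectivity of `ofKaehler` provides the form
    -- `V^0(α) + dV^0(0)` instead.
    obtain ⟨α, rfl⟩ := hE x
    have h : E.ofKaehler α = E.sequenceMiddle 0 (α, 0) := by
      rw [sequenceMiddle, VIter_self, VIter_self, map_zero, map_zero, map_zero, add_zero]
    rw [h] at hx ⊢
    exact sequenceMiddle_eq_zero_of_V hA sequenceMiddle_zero_comp_sequenceLeft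
      (hexact 1 le_rfl).exact_left hx
  | succ n ih =>
    have hR : E.R x = 0 := ih (by rw [← E.R_V, hx, map_zero])
    obtain ⟨⟨α, a⟩, rfl⟩ := ((hexact (n + 1) (Nat.le_add_left 1 n)).exact_right x).mp hR
    exact sequenceMiddle_eq_zero_of_V hA
      (hexact (n + 1) (Nat.le_add_left 1 n)).exact_left.comp_eq_zero
      (hexact (n + 2) (Nat.le_add_left 1 _)).exact_left hx

theorem VIter_injective {n k i : ℕ} (h : n ≤ k)
    (hV : ∀ l, n ≤ l → Function.Injective (E.V : E.X l i →+ E.X (l + 1) i)) :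
    Function.Injective (E.VIter h : E.X n i → E.X k i) := by
  induction k, h using Nat.le_induction with
  | base => exact fun x y hxy => by rwa [VIter_self, VIter_self] at hxy
  | succ k h ih =>
    intro x y hxy
    rw [E.VIter_succ _ h, E.VIter_succ _ h] at hxy
    exact ih (hV k h hxy)

end WittComplex

theorem mainTheorem6 (p : ℕ) [Fact p.Prime] (hp : p ≠ 2)
    (A : Type u) [CommRing A] [Algebra (ZLocalized p) A]
    (hA : ∀ a : A, (p : A) * a = 0 → a = 0)
    (hexact : ∀ n : ℕ, 1 ≤ n → (deRhamWitt p A).IsSequenceExact n)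
    (m n : ℕ) (hm : 1 ≤ m) (hn : 1 ≤ n) :
    Function.Injective
      ((deRhamWitt p A).VIter (Nat.le_add_right n m) :
        (deRhamWitt p A).X n 1 → (deRhamWitt p A).X (n + m) 1) := by
  refine WittComplex.VIter_injective _ fun l hl => ?_
  -- All levels met are at least `n ≥ 1`, so the zero object at level `0` never occurs.
  obtain ⟨l, rfl⟩ : ∃ l', l = l' + 1 := ⟨l - 1, by omega⟩
  exact (injective_iff_map_eq_zero _).mpr fun x hx =>
    WittComplex.eq_zero_of_V_eq_zero hA (deRhamWitt_ofKaehler_surjective p A) hexact l hx
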